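/- All Banach spaces are real, and all constants below take values in $[0,\infty]$, with $\inf\emptyset=\infty$, $\sup\emptyset=0$ and $0\cdot\infty=0$. For a metric space $Y$, a subset $X\subset Y$ with the induced metric, a Banach space $E$ and a Lipschitz map $f\colon X\to E$, let $\operatorname{Lip}(f)$ be the infimum of all $L\ge 0$ such that $f$ is $L$-Lipschitz, and let $e(X,Y,E,f)$ be the infimum of all $K\ge 0$ for which $f$ has a $K\operatorname{Lip}(f)$-Lipschitz extension $\bar f\colon Y\to E$. For a class $\mathcal B$ of Banach spaces put $$\nu_{\mathcal B}(X,Y)=\sup\{e(X,Y,E,f): E\in\mathcal B,\ f\colon X\to E\text{ Lipschitz}\},\qquad \nu_{\mathcal B}(Y)=\sup_{X\subset Y}\nu_{\mathcal B}(X,Y).$$ Write $\nu(X,Y)$ for $\nu_{\mathcal B}(X,Y)$ when $\mathcal B$ is the class of all Banach spaces, $\nu_{\mathrm{fin}}(Y)$ for $\nu_{\mathcal B}(Y)$ when $\mathcal B$ is the class of all finite-dimensional Banach spaces, and $\nu_{\mathrm{dual}}(Y)$ when $\mathcal B$ is the class of all dual Banach spaces, that is, those linearly isometric to the dual of a Banach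 space. For a pointed metric space $(X,p)$ let $\operatorname{Lip}_0(X)$ be the Banach space of all Lipschitz functions $f\colon X\to\mathbb R$ with $f(p)=0$, with the norm $\sup_{x\ne x'}|f(x)-f(x')|/d(x,x')$. For $p\in X\subset Y$ let $\lambda_{\mathrm{Lip}}(X,Y)$ be the infimum of $\|T\|$ over all bounded linear maps $T\colon\operatorname{Lip}_0(X)\to\operatorname{Lip}_0(Y)$ with $(Tf)|_X=f$ for all $f$, both spaces being formed with the base point $p$; this does not depend on $p$. Put $\lambda_{\mathrm{Lip}}(\emptyset,Y)=0$ and $\lambda_{\mathrm{Lip}}(Y)=\sup_{X\subset Y}\lambda_{\mathrm{Lip}}(X,Y)$. **Theorem.** Let $Y$ be a metric space, $X\subset Y$ a subset and $\mathcal B$ a class of Banach spaces. Put $K_{\mathcal B}=\sup\{\nu(E,E^{**}):E\in\mathcal B\}$, where $E$ is regarded as a subset of its bidual $E^{**}$ through the canonical embedding. Then $$\nu_{\mathcal B}(X,Y)\le K_{\mathcal B}\cdot\sup_F\lambda_{\mathrm{Lip}}(F,Y),$$ where the supremum is taken over all finite subsets $F\subset X$. Moreover, if $X$ is nonempty and $\operatorname{Lip}_0(X)^*$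 belongs to $\mathcal B$ (up to linear isometry), then $$\lambda_{\mathrm{Lip}}(X,Y)\le\nu_{\mathcal B}(X,Y).$$ As a consequence, $$\lambda_{\mathrm{Lip}}(Y)=\nu_{\mathrm{dual}}(Y)=\nu_{\mathrm{fin}}(Y).$$ -/

import Mathlib

open scoped NNReal ENNReal

universe u v

noncomputable section

namespace LipExt

/-- `Lip(f)`, the infimum of all `L ≥ 0` for which `f` is `L`-Lipschitz. -/
def lipConst {X : Type u} {E : Type v} [MetricSpace X] [MetricSpace E] (f : X → E) : ℝ≥0 :=
  sInf {L : ℝ≥0 | LipschitzWith L f}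

section Lip0

variable {X : Type u} [MetricSpace X]

/-- The real Lipschitz functions on `X` that vanish at `p`, as a linear subspace of `X → ℝ`. -/
def lip0Submodule (p : X) : Submodule ℝ (X → ℝ) where
  carrier := {f | f p = 0 ∧ ∃ L : ℝ≥0, LipschitzWith L f}
  zero_mem' := ⟨rfl, 0, LipschitzWith.const 0⟩
  add_mem' := by
    rintro f g ⟨hf, K, hK⟩ ⟨hg, L, hL⟩
    exact ⟨by simp [hf, hg], K + L, hK.add hL⟩
  smul_mem' := by
    rintro c f ⟨hf, K, hK⟩
    refine ⟨by simp [hf], ‖c‖₊ * K, ?_⟩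
    refine LipschitzWith.of_dist_le_mul fun x y => ?_
    have h := hK.dist_le_mul x y
    simp only [Pi.smul_apply, smul_eq_mul, Real.dist_eq, NNReal.coe_mul, coe_nnnorm,
      Real.norm_eq_abs] at h ⊢
    rw [← mul_sub, abs_mul, mul_assoc]
    exact mul_le_mul_of_nonneg_left h (abs_nonneg c)

/-- The space `Lip₀(X)` of the pointed metric space `(X, p)`. It is a type of its own, so that it
carries no topology but that of the Lipschitz norm. -/
def Lip0 (p : X) : Type u := lip0Submodule p

variable {p : X}

instance : AddCommGroup (Lip0 p) := inferInstanceAs (AddCommGroup (lip0Submodule p))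

instance : Module ℝ (Lip0 p) := inferInstanceAs (Module ℝ (lip0Submodule p))

instance : CoeFun (Lip0 p) (fun _ => X → ℝ) := ⟨fun f => f.1⟩

/-- The Lipschitz norm `sup_{x ≠ x'} |f x - f x'| / d(x, x')`; the pairs with `x = x'` contribute
`0 / 0 = 0`. -/
instance : Norm (Lip0 p) := ⟨fun f => ⨆ z : X × X, |f z.1 - f z.2| / dist z.1 z.2⟩

theorem Lip0.norm_def (f : Lip0 p) : ‖f‖ = ⨆ z : X × X, |f z.1 - f z.2| / dist z.1 z.2 := rfl

@[ext] theorem Lip0.ext {f g : Lip0 p} (h : ∀ x, f x = g x) : f = g := Subtype.ext (funext h)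

@[simp] theorem Lip0.add_apply (f g : Lip0 p) (x : X) : (f + g) x = f x + g x := rfl

@[simp] theorem Lip0.neg_apply (f : Lip0 p) (x : X) : (-f) x = -f x := rfl

@[simp] theorem Lip0.sub_apply (f g : Lip0 p) (x : X) : (f - g) x = f x - g x := rfl

@[simp] theorem Lip0.smul_apply (c : ℝ) (f : Lip0 p) (x : X) : (c • f) x = c * f x := rfl

@[simp] theorem Lip0.zero_apply (x : X) : (0 : Lip0 p) x = 0 := rfl

@[simp] theorem Lip0.base_apply (f : Lip0 p) : f p = 0 := f.2.1

theorem Lip0.bddAbove (f : Lip0 p) :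
    BddAbove (Set.range fun z : X × X => |f z.1 - f z.2| / dist z.1 z.2) := by
  obtain ⟨-, L, hL⟩ := f.2
  refine ⟨L, ?_⟩
  rintro _ ⟨z, rfl⟩
  exact div_le_of_le_mul₀ dist_nonneg L.2 (hL.dist_le_mul z.1 z.2)

theorem Lip0.abs_sub_le (f : Lip0 p) (x y : X) : |f x - f y| ≤ ‖f‖ * dist x y := by
  rcases eq_or_ne x y with rfl | h
  · simp
  · exact (div_le_iff₀ (dist_pos.2 h)).1 (le_ciSup f.bddAbove (x, y))

theorem Lip0.norm_le (f : Lip0 p) {C : ℝ} (hC : 0 ≤ C)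
    (h : ∀ x y, |f x - f y| ≤ C * dist x y) : ‖f‖ ≤ C :=
  Real.iSup_le (fun z => div_le_of_le_mul₀ dist_nonneg hC (h z.1 z.2)) hC

theorem Lip0.norm_nonneg' (f : Lip0 p) : 0 ≤ ‖f‖ :=
  Real.iSup_nonneg fun _ => div_nonneg (abs_nonneg _) dist_nonneg

theorem Lip0.norm_smul_le' (c : ℝ) (f : Lip0 p) : ‖c • f‖ ≤ |c| * ‖f‖ := by
  refine Lip0.norm_le _ (mul_nonneg (abs_nonneg c) f.norm_nonneg') fun x y => ?_
  rw [Lip0.smul_apply, Lip0.smul_apply, ← mul_sub, abs_mul, mul_assoc]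
  exact mul_le_mul_of_nonneg_left (f.abs_sub_le x y) (abs_nonneg c)

theorem Lip0.normedSpaceCore : NormedSpace.Core ℝ (Lip0 p) where
  norm_nonneg := Lip0.norm_nonneg'
  norm_smul c f := by
    refine le_antisymm (Lip0.norm_smul_le' c f) ?_
    rcases eq_or_ne c 0 with rfl | hc
    · simpa using Lip0.norm_nonneg' ((0 : ℝ) • f)
    · have h := Lip0.norm_smul_le' c⁻¹ (c • f)
      rw [smul_smul, inv_mul_cancel₀ hc, one_smul, abs_inv] at h
      have hc' : 0 < |c| := abs_pos.2 hc
      rw [Real.norm_eq_abs]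
      calc |c| * ‖f‖ ≤ |c| * (|c|⁻¹ * ‖c • f‖) := mul_le_mul_of_nonneg_left h hc'.le
        _ = ‖c • f‖ := by rw [← mul_assoc, mul_inv_cancel₀ hc'.ne', one_mul]
  norm_triangle f g := by
    refine Lip0.norm_le _ (add_nonneg f.norm_nonneg' g.norm_nonneg') fun x y => ?_
    have hf := f.abs_sub_le x y
    have hg := g.abs_sub_le x y
    have h := abs_add_le (f x - f y) (g x - g y)
    have e : (f + g) x - (f + g) y = (f x - f y) + (g x - g y) := by
      simp only [Lip0.add_apply]; ring
    rw [e, add_mul]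
    linarith
  norm_eq_zero_iff f := by
    constructor
    · intro h
      ext x
      have hx := f.abs_sub_le x p
      rw [h, zero_mul, Lip0.base_apply, sub_zero] at hx
      simpa using hx
    · rintro rfl
      exact le_antisymm (Lip0.norm_le _ le_rfl (by simp)) (Lip0.norm_nonneg' _)

instance : NormedAddCommGroup (Lip0 p) := NormedAddCommGroup.ofCore Lip0.normedSpaceCore

instance : NormedSpace ℝ (Lip0 p) := NormedSpace.ofCore Lip0.normedSpaceCore

end Lip0

section Linear

variable {Y : Type u} [MetricSpace Y]

/-- `T` is a linear extension operator for `X ⊆ Y`, with respect to the base point `p ∈ X`. -/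
def IsExtensionOperator (X : Set Y) (p : X) (T : Lip0 p →L[ℝ] Lip0 (p : Y)) : Prop :=
  ∀ (f : Lip0 p) (x : X), T f (x : Y) = f x

/-- `λ_Lip(X, Y)` computed with the base point `p ∈ X` (`∞` if there is no linear extension
operator). -/
def lambdaLipAt (X : Set Y) (p : X) : ℝ≥0∞ :=
  ⨅ (T : Lip0 p →L[ℝ] Lip0 (p : Y)) (_ : IsExtensionOperator X p T), ‖T‖ₑ

/-- `λ_Lip(X, Y)`. The value does not depend on the base point (`lambdaLip_eq`), so the supremum
only removes the choice of one; it is `0` for empty `X`, which has no base point. -/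
def lambdaLip (X : Set Y) : ℝ≥0∞ := ⨆ p : X, lambdaLipAt X p

/-- Change of base point, `f ↦ f - f q`. -/
def Lip0.shift {X : Type u} [MetricSpace X] (p q : X) : Lip0 p →L[ℝ] Lip0 q :=
  LinearMap.mkContinuous
    { toFun := fun f => ⟨fun x => f x - f q, sub_self _, by
        obtain ⟨-, L, hL⟩ := f.2
        exact ⟨L, LipschitzWith.of_dist_le_mul fun x y => by
          simpa [Real.dist_eq] using hL.dist_le_mul x y⟩⟩
      map_add' := fun f g => Lip0.ext fun x => add_sub_add_comm (f x) (g x) (f q) (g q)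
      map_smul' := fun c f => Lip0.ext fun x => (mul_sub c (f x) (f q)).symm }
    1 (fun f => by
      rw [one_mul]
      refine Lip0.norm_le _ f.norm_nonneg' fun x y => ?_
      have e : (f x - f q) - (f y - f q) = f x - f y := by ring
      exact (congrArg abs e).trans_le (f.abs_sub_le x y))

theorem Lip0.shift_apply {X : Type u} [MetricSpace X] (p q : X) (f : Lip0 p) (x : X) :
    Lip0.shift p q f x = f x - f q := rfl

theorem Lip0.norm_shift_le {X : Type u} [MetricSpace X] (p q : X) : ‖Lip0.shift p q‖ ≤ 1 :=
  LinearMap.mkContinuous_norm_le _ zero_le_one _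

theorem lambdaLipAt_le (X : Set Y) (p q : X) : lambdaLipAt X q ≤ lambdaLipAt X p := by
  refine le_iInf₂ fun T hT => ?_
  refine iInf₂_le_of_le
    ((Lip0.shift (p : Y) (q : Y)).comp (T.comp (Lip0.shift q p))) (fun f x => ?_) ?_
  · have h1 := hT (Lip0.shift q p f) x
    have h2 := hT (Lip0.shift q p f) q
    simp only [ContinuousLinearMap.comp_apply]
    rw [Lip0.shift_apply, h1, h2, Lip0.shift_apply, Lip0.shift_apply, Lip0.base_apply]
    ring
  · rw [enorm_le_iff_norm_le]
    calc _ ≤ ‖Lip0.shift (p : Y) (q : Y)‖ * (‖T‖ * ‖Lip0.shift q p‖) :=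
          (ContinuousLinearMap.opNorm_comp_le _ _).trans
            (mul_le_mul_of_nonneg_left (ContinuousLinearMap.opNorm_comp_le _ _) (norm_nonneg _))
      _ ≤ 1 * (‖T‖ * 1) := by
          gcongr
          · exact Lip0.norm_shift_le _ _
          · exact Lip0.norm_shift_le _ _
      _ = ‖T‖ := by ring

theorem lambdaLip_eq (X : Set Y) (p : X) : lambdaLip X = lambdaLipAt X p :=
  le_antisymm (iSup_le fun q => lambdaLipAt_le X p q) (le_iSup (lambdaLipAt X) p)

/-- `λ_Lip(Y)`. -/
def lambdaLipSpace (Y : Type u) [MetricSpace Y] : ℝ≥0∞ := ⨆ X : Set Y, lambdaLip X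

end Linear

section NonLinear

/-- A class of real Banach spaces. -/
def BanachClass : Type (u + 1) :=
  ∀ (E : Type u) [NormedAddCommGroup E] [NormedSpace ℝ E] [CompleteSpace E], Prop

/-- The class of all Banach spaces. -/
def BanachClass.all : BanachClass.{u} := fun _ _ _ _ => True

/-- The class of all finite-dimensional Banach spaces. -/
def BanachClass.fin : BanachClass.{u} := fun E _ _ _ => FiniteDimensional ℝ E

/-- The class of all dual Banach spaces: those linearly isometric to the dual `G*` of a Banach
space `G`. -/
def BanachClass.dual : BanachClass.{u} := fun E _ _ _ =>
  ∃ (G : Type u) (_ : NormedAddCommGroup G) (_ : NormedSpace ℝ G) (_ : CompleteSpace G),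
    Nonempty (E ≃ₗᵢ[ℝ] StrongDual ℝ G)

/-- `V` belongs to `𝓑`, Banach spaces being identified when they are linearly isometric. -/
def BanachClass.Contains (𝓑 : BanachClass.{u}) (V : Type u) [NormedAddCommGroup V]
    [NormedSpace ℝ V] : Prop :=
  ∃ (E : Type u) (_ : NormedAddCommGroup E) (_ : NormedSpace ℝ E) (_ : CompleteSpace E),
    𝓑 E ∧ Nonempty (V ≃ₗᵢ[ℝ] E)

variable {Y : Type u} [MetricSpace Y]

/-- `e(X, Y, E, f)`, the infimum of all `K ≥ 0` such that `f` has a `K Lip(f)`-Lipschitz extension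
to `Y` (`∞` if there is no such `K`). -/
def extConst (X : Set Y) {E : Type v} [MetricSpace E] (f : X → E) : ℝ≥0∞ :=
  ⨅ (K : ℝ≥0) (_ : ∃ g : Y → E, LipschitzWith (K * lipConst f) g ∧ ∀ x : X, g x = f x),
    (K : ℝ≥0∞)

/-- `ν_𝓑(X, Y)`, the supremum of `e(X, Y, E, f)` over all `E ∈ 𝓑` and Lipschitz `f : X → E`. -/
def nuClass (𝓑 : BanachClass.{u}) (X : Set Y) : ℝ≥0∞ :=
  ⨆ (E : Type u) (_ : NormedAddCommGroup E) (_ : NormedSpace ℝ E) (_ : CompleteSpace E)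
    (_ : 𝓑 E) (f : X → E) (_ : ∃ L : ℝ≥0, LipschitzWith L f), extConst X f

/-- `ν(X, Y)`, the supremum of `e(X, Y, E, f)` over all Banach spaces `E` and Lipschitz `f`. -/
def nu (X : Set Y) : ℝ≥0∞ := nuClass BanachClass.all X

/-- `ν_𝓑(Y)`. -/
def nuClassSpace (𝓑 : BanachClass.{u}) (Y : Type u) [MetricSpace Y] : ℝ≥0∞ :=
  ⨆ X : Set Y, nuClass 𝓑 X

/-- `ν(E, E**)`, where `E` is the subset of its bidual given by the canonical embedding. -/
def nuBidual (E : Type u) [NormedAddCommGroup E] [NormedSpace ℝ E] : ℝ≥0∞ :=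
  nu (Set.range (NormedSpace.inclusionInDoubleDual ℝ E))

/-- `K_𝓑 = sup {ν(E, E**) : E ∈ 𝓑}`. -/
def bidualConst (𝓑 : BanachClass.{u}) : ℝ≥0∞ :=
  ⨆ (E : Type u) (_ : NormedAddCommGroup E) (_ : NormedSpace ℝ E) (_ : CompleteSpace E)
    (_ : 𝓑 E), nuBidual E

end NonLinear

end LipExt

end

/-! Linear extension operators and Lipschitz extensions are exchanged by duality through the
evaluations `δ_x ∈ Lip₀(X)*`. Given an extension operator `T` and `f : X → E`, the map `y ↦ (φ ↦ T(φ
∘ (f - f p))(y))`, shifted by `f p`, extends `f` with values in `E**`, with constant `‖T‖ Lip(f)`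
(`IsExtensionOperator.exists_bidual_extension`). Operators for finite `F ⊆ X` suffice, because balls
of `E**` are weak* compact (`exists_extension_dual_of_finite`). Returning from `E**` to `E` costs a
factor `K_𝓑` (`nuClass_le_mul`). Conversely, `x ↦ δ_x` is 1-Lipschitz, and an extension `g : Y →
Lip₀(X)*` of it defines the linear operator `f ↦ (y ↦ g(y)(f))` (`lambdaLip_le_nuClass`). For dual
spaces the return to `E` costs nothing (`nuBidual_le_one_of_dual`), and for finite `F` the space
`Lip₀(F)*` is finite-dimensional; hence the equalities. -/

namespace LipExt

open Filter Topology

/-! ### Evaluations, completeness and duality for `Lip₀` -/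

section Lip0

variable {X : Type u} [MetricSpace X] {p : X}

/-- Evaluation at a point, as a bounded functional on `Lip₀(X)`. -/
noncomputable def Lip0.eval (p x : X) : StrongDual ℝ (Lip0 p) :=
  LinearMap.mkContinuous
    { toFun := fun f => f x
      map_add' := fun _ _ => rfl
      map_smul' := fun _ _ => rfl }
    (dist x p) (fun f => by
      have h := f.abs_sub_le x p
      rw [Lip0.base_apply, sub_zero] at h
      rw [mul_comm]
      exact h)

theorem Lip0.eval_apply (x : X) (f : Lip0 p) : Lip0.eval p x f = f x := rfl

theorem Lip0.lipschitzWith_eval (p : X) : LipschitzWith 1 (Lip0.eval p) := by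
  refine LipschitzWith.of_dist_le_mul fun x y => ?_
  rw [NNReal.coe_one, one_mul, dist_eq_norm]
  refine ContinuousLinearMap.opNorm_le_bound _ dist_nonneg fun f => ?_
  rw [mul_comm]
  exact f.abs_sub_le x y

/-- Makes `Lip0 p` a Banach predual, so that its dual lies in `BanachClass.dual`. Cauchy bounds on
slopes pass to the pointwise limit. -/
instance : CompleteSpace (Lip0 p) := by
  refine Metric.complete_of_cauchySeq_tendsto fun u hu => ?_
  have hc : ∀ x, ∃ a, Tendsto (fun n => u n x) atTop (𝓝 a) := fun x =>
    cauchySeq_tendsto_of_complete ((Lip0.eval p x).uniformContinuous.comp_cauchySeq hu)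
  choose a ha using hc
  have hbound : ∀ ε > 0, ∃ N, ∀ n ≥ N, ∀ x y,
      |(u n x - a x) - (u n y - a y)| ≤ ε * dist x y := by
    intro ε hε
    obtain ⟨N, hN⟩ := Metric.cauchySeq_iff.1 hu ε hε
    refine ⟨N, fun n hn x y => ?_⟩
    refine le_of_tendsto (((tendsto_const_nhds.sub (ha x)).sub
      (tendsto_const_nhds.sub (ha y))).abs) ?_
    filter_upwards [eventually_ge_atTop N] with m hm
    have h1 := (u n - u m).abs_sub_le x y
    have h2 := hN n hn m hm
    rw [dist_eq_norm] at h2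
    exact h1.trans (mul_le_mul_of_nonneg_right h2.le dist_nonneg)
  have hmem : a ∈ lip0Submodule p := by
    refine ⟨tendsto_nhds_unique (ha p) (by simp), ?_⟩
    obtain ⟨N, hN⟩ := hbound 1 one_pos
    refine ⟨‖u N‖₊ + 1, LipschitzWith.of_dist_le_mul fun x y => ?_⟩
    have h1 := abs_le.1 (hN N le_rfl x y)
    have h2 := abs_le.1 ((u N).abs_sub_le x y)
    simp only [NNReal.coe_add, coe_nnnorm, NNReal.coe_one, Real.dist_eq]
    rw [add_mul, abs_le]
    constructor <;> linarith [h1.1, h1.2, h2.1, h2.2]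
  refine ⟨⟨a, hmem⟩, Metric.tendsto_atTop.2 fun ε hε => ?_⟩
  obtain ⟨N, hN⟩ := hbound (ε / 2) (half_pos hε)
  refine ⟨N, fun n hn => ?_⟩
  let b : Lip0 p := ⟨a, hmem⟩
  exact (dist_eq_norm (u n) b).trans_lt
    ((Lip0.norm_le _ (half_pos hε).le (hN n hn)).trans_lt (half_lt_self hε))

instance [Finite X] : FiniteDimensional ℝ (Lip0 p) :=
  inferInstanceAs (FiniteDimensional ℝ (lip0Submodule p))

/-- The map `φ ↦ φ ∘ (f - f p)` from `E*` to `Lip₀(X)`, for a Lipschitz map `f : X → E`. -/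
noncomputable def Lip0.ofDual {E : Type v} [NormedAddCommGroup E] [NormedSpace ℝ E] (p : X)
    {f : X → E} {C : ℝ≥0} (hf : LipschitzWith C f) : StrongDual ℝ E →L[ℝ] Lip0 p :=
  LinearMap.mkContinuous
    { toFun := fun φ => ⟨fun x => φ (f x - f p), by simp, ‖φ‖₊ * C,
        LipschitzWith.of_dist_le_mul fun x y => by
          rw [Real.dist_eq, ← map_sub, sub_sub_sub_cancel_right, NNReal.coe_mul, mul_assoc]
          refine (φ.le_opNorm _).trans ?_
          rw [← dist_eq_norm]
          exact mul_le_mul_of_nonneg_left (hf.dist_le_mul x y) (norm_nonneg _)⟩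
      map_add' := fun _ _ => rfl
      map_smul' := fun _ _ => rfl }
    C (fun φ => by
      refine Lip0.norm_le _ (by positivity) fun x y => ?_
      change |φ (f x - f p) - φ (f y - f p)| ≤ _
      rw [← map_sub, sub_sub_sub_cancel_right, mul_comm (C : ℝ), mul_assoc]
      refine (φ.le_opNorm _).trans ?_
      rw [← dist_eq_norm]
      exact mul_le_mul_of_nonneg_left (hf.dist_le_mul x y) (norm_nonneg _))

theorem Lip0.ofDual_apply {E : Type v} [NormedAddCommGroup E] [NormedSpace ℝ E] (p : X)
    {f : X → E} {C : ℝ≥0} (hf : LipschitzWith C f) (φ : StrongDual ℝ E) (x : X) :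
    Lip0.ofDual p hf φ x = φ (f x - f p) := rfl

theorem Lip0.norm_ofDual_le {E : Type v} [NormedAddCommGroup E] [NormedSpace ℝ E] (p : X)
    {f : X → E} {C : ℝ≥0} (hf : LipschitzWith C f) : ‖Lip0.ofDual p hf‖ ≤ C :=
  LinearMap.mkContinuous_norm_le _ C.2 _

end Lip0

/-! ### Lipschitz and extension constants -/

section Constants

theorem lipConst_le {X : Type u} {E : Type v} [MetricSpace X] [MetricSpace E] {f : X → E}
    {L : ℝ≥0} (hf : LipschitzWith L f) : lipConst f ≤ L :=
  csInf_le' hf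

/-- The infimum is attained: each slope is a lower bound for the admissible constants. -/
theorem lipschitzWith_lipConst {X : Type u} {E : Type v} [MetricSpace X] [MetricSpace E]
    {f : X → E} (hf : ∃ L : ℝ≥0, LipschitzWith L f) : LipschitzWith (lipConst f) f := by
  refine LipschitzWith.of_dist_le_mul fun x y => ?_
  suffices nndist (f x) (f y) ≤ lipConst f * nndist x y from mod_cast this
  rcases eq_or_ne x y with rfl | h
  · simp
  · have hd : 0 < nndist x y := pos_iff_ne_zero.2 (nndist_eq_zero.not.2 h)
    rw [← div_le_iff₀ hd]
    exact le_csInf hf fun L hL => (div_le_iff₀ hd).2 (hL.nndist_le x y)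

variable {Y : Type u} [MetricSpace Y]

theorem extConst_le {X : Set Y} {E : Type v} [MetricSpace E] {f : X → E} {K : ℝ≥0} {g : Y → E}
    (hg : LipschitzWith (K * lipConst f) g) (hgf : ∀ x : X, g x = f x) : extConst X f ≤ K :=
  iInf₂_le K ⟨g, hg, hgf⟩

theorem exists_extension_of_extConst_lt {X : Set Y} {E : Type v} [MetricSpace E] {f : X → E}
    {c : ℝ≥0} (h : extConst X f < c) :
    ∃ g : Y → E, LipschitzWith (c * lipConst f) g ∧ ∀ x : X, g x = f x := by
  simp only [extConst, iInf_lt_iff] at h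
  obtain ⟨K, ⟨g, hg, hgf⟩, hK⟩ := h
  exact ⟨g, hg.weaken (mul_le_mul_left (ENNReal.coe_lt_coe.1 hK).le _), hgf⟩

theorem extConst_eq_zero_of_forall_eq {X : Set Y} {E : Type v} [MetricSpace E] [Nonempty E]
    {f : X → E} (hf : ∀ x y, f x = f y) : extConst X f = 0 := by
  have h : ∃ c, ∀ x, f x = c := by
    rcases isEmpty_or_nonempty X with hX | ⟨⟨p⟩⟩
    · exact ⟨Classical.arbitrary E, fun x => hX.elim x⟩
    · exact ⟨f p, fun x => hf x p⟩
  obtain ⟨c, hc⟩ := h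
  refine le_antisymm (extConst_le (K := 0) (g := fun _ => c) ?_ fun x => (hc x).symm) zero_le
  rw [zero_mul]
  exact LipschitzWith.const c

theorem extConst_le_nuClass {𝓑 : BanachClass.{u}} {E : Type u} [NormedAddCommGroup E]
    [NormedSpace ℝ E] [CompleteSpace E] (hE : 𝓑 E) {X : Set Y} {f : X → E}
    (hf : ∃ L : ℝ≥0, LipschitzWith L f) : extConst X f ≤ nuClass 𝓑 X :=
  le_iSup_of_le E <| le_iSup_of_le inferInstance <| le_iSup_of_le inferInstance <|
    le_iSup_of_le inferInstance <| le_iSup_of_le hE <| le_iSup_of_le f <| le_iSup_of_le hf le_rfl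

theorem nuClass_le {𝓑 : BanachClass.{u}} {X : Set Y} {c : ℝ≥0∞}
    (h : ∀ (E : Type u) [NormedAddCommGroup E] [NormedSpace ℝ E] [CompleteSpace E], 𝓑 E →
      ∀ f : X → E, (∃ L : ℝ≥0, LipschitzWith L f) → extConst X f ≤ c) : nuClass 𝓑 X ≤ c :=
  iSup_le fun E => iSup_le fun _ => iSup_le fun _ => iSup_le fun _ => iSup_le fun hE =>
    iSup_le fun f => iSup_le fun hf => h E hE f hf

theorem nuBidual_le_bidualConst {𝓑 : BanachClass.{u}} {E : Type u} [NormedAddCommGroup E]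
    [NormedSpace ℝ E] [CompleteSpace E] (hE : 𝓑 E) : nuBidual E ≤ bidualConst 𝓑 :=
  le_iSup_of_le E <| le_iSup_of_le inferInstance <| le_iSup_of_le inferInstance <|
    le_iSup_of_le inferInstance <| le_iSup_of_le hE le_rfl

theorem nuClass_mono {𝓐 𝓑 : BanachClass.{u}}
    (h : ∀ (E : Type u) [NormedAddCommGroup E] [NormedSpace ℝ E] [CompleteSpace E], 𝓐 E → 𝓑 E)
    (X : Set Y) : nuClass 𝓐 X ≤ nuClass 𝓑 X :=
  nuClass_le fun E _ _ _ hE _ hf => extConst_le_nuClass (h E hE) hf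

/-- Extending `dist(·, x)`, of norm at most 1, preserves its slope 1 between `x` and `y`. This
serves to rule out a product `∞ * 0` in `nuClass_le_mul`. -/
theorem one_le_lambdaLip {F : Set Y} (hF : F.Nontrivial) : 1 ≤ lambdaLip F := by
  obtain ⟨x, hx, y, hy, hxy⟩ := hF
  rw [lambdaLip_eq F ⟨x, hx⟩]
  refine le_iInf₂ fun T hT => ?_
  let f : Lip0 (⟨x, hx⟩ : F) := ⟨fun z => dist (z : Y) x, dist_self x, 1,
    LipschitzWith.of_dist_le_mul fun a b => by
      rw [NNReal.coe_one, one_mul]; exact dist_dist_dist_le_left (a : Y) b x⟩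
  have hf1 : ‖f‖ ≤ 1 := Lip0.norm_le _ zero_le_one fun a b => by
    rw [one_mul]; exact dist_dist_dist_le_left (a : Y) b x
  have h1 : T f y = dist y x := hT f ⟨y, hy⟩
  have h2 := (T f).abs_sub_le y x
  rw [show T f x = 0 from (T f).base_apply, sub_zero, h1, abs_of_nonneg dist_nonneg] at h2
  have h3 : 1 ≤ ‖T f‖ := (le_mul_iff_one_le_left (dist_pos.2 hxy.symm)).1 h2
  have h4 : 1 ≤ ‖T‖ := h3.trans ((T.le_opNorm f).trans
    (mul_le_of_le_one_right (norm_nonneg _) hf1))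
  rw [← enorm_one (G := ℝ), enorm_le_iff_norm_le]
  simpa using h4

end Constants

/-! ### Extension into biduals: linear operators and weak* compactness -/

section Extension

variable {Y : Type u} [MetricSpace Y]

theorem exists_extensionOperator_of_lambdaLip_lt {X : Set Y} {c : ℝ≥0} (h : lambdaLip X < c)
    (p : X) : ∃ T : Lip0 p →L[ℝ] Lip0 (p : Y), IsExtensionOperator X p T ∧ ‖T‖ ≤ c := by
  rw [lambdaLip_eq X p] at h
  simp only [lambdaLipAt, iInf_lt_iff] at h
  obtain ⟨T, hT, hTc⟩ := h
  exact ⟨T, hT, (ENNReal.coe_lt_coe.1 hTc).le⟩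

/-- A linear extension operator for real Lipschitz functions extends Lipschitz maps into `E`, with
values in the bidual of `E`. -/
theorem IsExtensionOperator.exists_bidual_extension {X : Set Y} {p : X}
    {T : Lip0 p →L[ℝ] Lip0 (p : Y)} (hT : IsExtensionOperator X p T) {c : ℝ≥0} (hc : ‖T‖ ≤ c)
    {E : Type v} [NormedAddCommGroup E] [NormedSpace ℝ E] {f : X → E} {C : ℝ≥0}
    (hf : LipschitzWith C f) :
    ∃ g : Y → StrongDual ℝ (StrongDual ℝ E), LipschitzWith (c * C) g ∧
      ∀ x : X, g x = NormedSpace.inclusionInDoubleDual ℝ E (f x) := by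
  -- `Lip0.ofDual` normalizes `f` to vanish at `p`; the last summand restores the value `f p`.
  refine ⟨fun y => (Lip0.eval (p : Y) y).comp (T.comp (Lip0.ofDual p hf)) +
    NormedSpace.inclusionInDoubleDual ℝ E (f p), ?_, fun x => ?_⟩
  · refine LipschitzWith.of_dist_le_mul fun y z => ?_
    have h1 := (Lip0.lipschitzWith_eval (p : Y)).dist_le_mul y z
    rw [NNReal.coe_one, one_mul, dist_eq_norm] at h1
    rw [dist_add_right, dist_eq_norm, ← ContinuousLinearMap.sub_comp, NNReal.coe_mul, mul_comm]
    refine (ContinuousLinearMap.opNorm_comp_le _ _).trans ?_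
    refine mul_le_mul h1 ((ContinuousLinearMap.opNorm_comp_le _ _).trans ?_) (norm_nonneg _)
      dist_nonneg
    exact mul_le_mul hc (Lip0.norm_ofDual_le p hf) (norm_nonneg _) c.2
  · ext φ
    have h := hT (Lip0.ofDual p hf φ) x
    rw [Lip0.ofDual_apply, map_sub] at h
    simp only [_root_.add_apply, ContinuousLinearMap.comp_apply, Lip0.eval_apply,
      NormedSpace.dual_def, h]
    ring

/-- Compactness: a map into a dual space extends with Lipschitz constant `M` as soon as its
restrictions to finite sets do. -/
theorem exists_extension_dual_of_finite {G : Type v} [NormedAddCommGroup G] [NormedSpace ℝ G]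
    {X : Set Y} (h : X → StrongDual ℝ G) (M : ℝ≥0)
    (hfin : ∀ s : Finset X, ∃ g : Y → StrongDual ℝ G, LipschitzWith M g ∧ ∀ x ∈ s, g x = h x) :
    ∃ g : Y → StrongDual ℝ G, LipschitzWith M g ∧ ∀ x : X, g x = h x := by
  rcases isEmpty_or_nonempty X with hX | ⟨⟨p⟩⟩
  · exact ⟨fun _ => 0, LipschitzWith.const' 0, fun x => hX.elim x⟩
  choose g hg hgh using hfin
  -- Along an ultrafilter finer than `atTop`, every `x` eventually belongs to `s`, and bounded
  -- families have weak* limits.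
  let U : Ultrafilter (Finset X) := Ultrafilter.of atTop
  have hmem : ∀ x : X, ∀ᶠ s in (U : Filter (Finset X)), x ∈ s := fun x =>
    (Ultrafilter.of_le atTop) ((eventually_ge_atTop {x}).mono fun s hs => by simpa using hs)
  have hlim : ∀ y, ∃ w : WeakDual ℝ G,
      Tendsto (fun s => StrongDual.toWeakDual (g s y)) (U : Filter (Finset X)) (𝓝 w) := by
    intro y
    -- The radius comes from `g s p = h p`, valid once `p ∈ s`, and the `M`-Lipschitz bound.
    have hcpt := WeakDual.isCompact_closedBall (𝕜 := ℝ) (0 : StrongDual ℝ G)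
      (‖h p‖ + M * dist y p)
    obtain ⟨w, -, hw⟩ := hcpt.ultrafilter_le_nhds
      (U.map fun s => StrongDual.toWeakDual (g s y)) (by
        rw [le_principal_iff]
        change ∀ᶠ s in (U : Filter (Finset X)), _
        filter_upwards [hmem p] with s hs
        have h1 := (hg s).dist_le_mul y p
        rw [hgh s p hs, dist_eq_norm] at h1
        have h2 := norm_le_norm_add_norm_sub (h p) (g s y)
        rw [norm_sub_rev] at h2
        rw [Set.mem_preimage, mem_closedBall_zero_iff]
        change ‖g s y‖ ≤ _
        linarith)
    exact ⟨w, hw⟩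
  choose w hw using hlim
  have hw' : ∀ y φ, Tendsto (fun s => g s y φ) (U : Filter (Finset X)) (𝓝 (w y φ)) :=
    fun y φ => ((WeakDual.eval_continuous φ).tendsto _).comp (hw y)
  refine ⟨fun y => WeakDual.toStrongDual (w y), LipschitzWith.of_dist_le_mul fun y z => ?_,
    fun x => ?_⟩
  · rw [dist_eq_norm]
    refine ContinuousLinearMap.opNorm_le_bound _ (by positivity) fun φ => ?_
    refine le_of_tendsto ((hw' y φ).sub (hw' z φ)).norm (Eventually.of_forall fun s => ?_)
    have h1 := (hg s).dist_le_mul y z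
    rw [dist_eq_norm] at h1
    exact ((g s y - g s z).le_opNorm φ).trans (mul_le_mul_of_nonneg_right h1 (norm_nonneg _))
  · ext φ
    refine tendsto_nhds_unique (hw' x φ) (tendsto_const_nhds.congr' ?_)
    filter_upwards [hmem x] with s hs
    rw [hgh s x hs]

/-- `sup_F λ_Lip(F, Y)` over all finite `F ⊆ X`. -/
noncomputable def lambdaLipFinite (X : Set Y) : ℝ≥0∞ :=
  ⨆ (F : Set Y) (_ : F ⊆ X) (_ : F.Finite), lambdaLip F

theorem lambdaLip_le_lambdaLipFinite {X F : Set Y} (hFX : F ⊆ X) (hF : F.Finite) :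
    lambdaLip F ≤ lambdaLipFinite X :=
  le_iSup_of_le F <| le_iSup_of_le hFX <| le_iSup_of_le hF le_rfl

theorem exists_bidual_extension_of_lambdaLipFinite_lt {X : Set Y} {c : ℝ≥0}
    (h : lambdaLipFinite X < c) {E : Type v} [NormedAddCommGroup E] [NormedSpace ℝ E]
    {f : X → E} {C : ℝ≥0} (hf : LipschitzWith C f) :
    ∃ g : Y → StrongDual ℝ (StrongDual ℝ E), LipschitzWith (c * C) g ∧
      ∀ x : X, g x = NormedSpace.inclusionInDoubleDual ℝ E (f x) := by
  refine exists_extension_dual_of_finite (fun x => NormedSpace.inclusionInDoubleDual ℝ E (f x))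
    (c * C) fun s => ?_
  rcases s.eq_empty_or_nonempty with rfl | ⟨p, hp⟩
  · exact ⟨fun _ => 0, LipschitzWith.const' 0, by simp⟩
  let F : Set Y := Subtype.val '' (s : Set X)
  have hFX : F ⊆ X := by
    rintro _ ⟨x, -, rfl⟩
    exact x.2
  have hF : F.Finite := s.finite_toSet.image _
  obtain ⟨T, hT, hTc⟩ := exists_extensionOperator_of_lambdaLip_lt
    ((lambdaLip_le_lambdaLipFinite hFX hF).trans_lt h) (⟨p, p, hp, rfl⟩ : F)
  obtain ⟨g, hg, hgf⟩ := hT.exists_bidual_extension hTc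
    (f := fun x => f ⟨x, hFX x.2⟩)
    (LipschitzWith.of_dist_le_mul fun x y => hf.dist_le_mul ⟨x, hFX x.2⟩ ⟨y, hFX y.2⟩)
  exact ⟨g, hg, fun x hx => hgf ⟨x, x, hx, rfl⟩⟩

/-! ### The two inequalities between `ν` and `λ_Lip` -/

theorem one_le_extConst {X : Set Y} {E : Type v} [MetricSpace E] {f : X → E}
    (hf : ∃ L : ℝ≥0, LipschitzWith L f) {x y : X} (hxy : f x ≠ f y) : 1 ≤ extConst X f := by
  refine le_iInf₂ fun K ⟨g, hg, hgf⟩ => ?_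
  have h0 : 0 < lipConst f := by
    refine pos_iff_ne_zero.2 fun h => hxy ?_
    have h1 := (lipschitzWith_lipConst hf).dist_le_mul x y
    rw [h, NNReal.coe_zero, zero_mul] at h1
    exact dist_le_zero.1 h1
  have h2 : lipConst f ≤ K * lipConst f := lipConst_le <| LipschitzWith.of_dist_le_mul fun a b => by
    rw [← hgf a, ← hgf b]
    exact hg.dist_le_mul a b
  exact_mod_cast (le_mul_iff_one_le_left h0).1 h2

/-- Extend the inverse of `E → E**` to a map `r : E** → E` and compose it with the bidual extension
`g` of `f`: the constants multiply. -/
theorem nuClass_le_mul (X : Set Y) (𝓑 : BanachClass.{u}) :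
    nuClass 𝓑 X ≤ bidualConst 𝓑 * lambdaLipFinite X := by
  refine nuClass_le fun E _ _ _ hE f hf => ?_
  by_cases hconst : ∀ x y, f x = f y
  · rw [extConst_eq_zero_of_forall_eq hconst]
    exact zero_le
  push Not at hconst
  obtain ⟨x, y, hxy⟩ := hconst
  let i : E ≃ Set.range (NormedSpace.inclusionInDoubleDual ℝ E) :=
    Equiv.ofInjective _ (NormedSpace.inclusionInDoubleDualLi ℝ (E := E)).injective
  have hisom : Isometry i := (NormedSpace.inclusionInDoubleDualLi ℝ (E := E)).isometry
  have hi : LipschitzWith 1 i.symm := (hisom.right_inv i.apply_symm_apply).lipschitz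
  have hK : extConst _ i.symm ≤ bidualConst 𝓑 :=
    (extConst_le_nuClass (𝓑 := BanachClass.all) trivial ⟨1, hi⟩).trans
      (nuBidual_le_bidualConst hE)
  -- The infima need not be attained, so the bound is proved for all larger factors; passing to the
  -- limit requires both factors to be nonzero, which holds since `f` is nonconstant.
  have hK0 : bidualConst 𝓑 ≠ 0 := fun h => by
    have h1 := (one_le_extConst ⟨1, hi⟩ (x := i (f x)) (y := i (f y)) (by simpa using hxy)).trans hK
    simp [h] at h1
  have hL0 : lambdaLipFinite X ≠ 0 := fun h => by
    have hxy' : (x : Y) ≠ y := fun e => hxy (congrArg f (Subtype.ext e))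
    have h1 := (one_le_lambdaLip (Set.nontrivial_pair hxy')).trans
      (lambdaLip_le_lambdaLipFinite (X := X)
        (Set.insert_subset x.2 (Set.singleton_subset_iff.2 y.2)) (Set.toFinite _))
    simp [h] at h1
  refine ENNReal.le_mul_of_forall_lt (.inl hK0) (.inr hL0) fun k' hk' l' hl' => ?_
  obtain ⟨k, hk, hkk'⟩ := ENNReal.lt_iff_exists_nnreal_btwn.1 hk'
  obtain ⟨l, hl, hll'⟩ := ENNReal.lt_iff_exists_nnreal_btwn.1 hl'
  obtain ⟨r, hr, hri⟩ := exists_extension_of_extConst_lt (hK.trans_lt hk)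
  obtain ⟨g, hg, hgf⟩ :=
    exists_bidual_extension_of_lambdaLipFinite_lt hl (lipschitzWith_lipConst hf)
  have hrg : LipschitzWith (k * l * lipConst f) (r ∘ g) := by
    refine (hr.comp hg).weaken ?_
    rw [mul_assoc k l]
    exact mul_le_mul_left (mul_le_of_le_one_right' (lipConst_le hi)) _
  refine (extConst_le hrg fun z => ?_).trans ?_
  · rw [Function.comp_apply, hgf]
    exact (hri (i (f z))).trans (i.symm_apply_apply _)
  · rw [ENNReal.coe_mul]
    exact mul_le_mul' hkk'.le hll'.le

theorem lambdaLip_le_nuClass (X : Set Y) (𝓑 : BanachClass.{u}) (p : X)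
    (h : 𝓑.Contains (StrongDual ℝ (Lip0 p))) : lambdaLip X ≤ nuClass 𝓑 X := by
  obtain ⟨E, _, _, _, hE, ⟨e⟩⟩ := h
  have hδ : LipschitzWith 1 (e ∘ Lip0.eval p) := by
    simpa using e.lipschitz.comp (Lip0.lipschitzWith_eval p)
  refine le_trans ?_ (extConst_le_nuClass hE ⟨1, hδ⟩)
  rw [lambdaLip_eq X p]
  refine le_iInf₂ fun K ⟨g, hg, hgδ⟩ => ?_
  have hg' : ∀ x : X, e.symm (g x) = Lip0.eval p x := fun x => by
    rw [hgδ, Function.comp_apply, e.symm_apply_apply]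
  have hsub : ∀ (f : Lip0 p) (y z : Y),
      |e.symm (g y) f - e.symm (g z) f| ≤ K * ‖f‖ * dist y z := fun f y z => by
    have h1 := hg.dist_le_mul y z
    have h2 : ((K * lipConst (e ∘ Lip0.eval p) : ℝ≥0) : ℝ) ≤ K :=
      NNReal.coe_le_coe.2 (mul_le_of_le_one_right' (lipConst_le hδ))
    rw [← e.symm.dist_map, dist_eq_norm] at h1
    calc |e.symm (g y) f - e.symm (g z) f| ≤ ‖e.symm (g y) - e.symm (g z)‖ * ‖f‖ :=
          (e.symm (g y) - e.symm (g z)).le_opNorm f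
      _ ≤ (K * dist y z) * ‖f‖ := by
          refine mul_le_mul_of_nonneg_right (h1.trans ?_) (norm_nonneg _)
          exact mul_le_mul_of_nonneg_right h2 dist_nonneg
      _ = K * ‖f‖ * dist y z := by ring
  -- Linearity in `f` is automatic, each `e.symm (g y)` being a functional; `g` itself need not have
  -- any linear structure.
  let T : Lip0 p →L[ℝ] Lip0 (p : Y) := LinearMap.mkContinuous
    { toFun := fun f => ⟨fun y => e.symm (g y) f, by
          change e.symm (g p) f = 0
          rw [hg', Lip0.eval_apply, Lip0.base_apply], K * ‖f‖₊,
        LipschitzWith.of_dist_le_mul (hsub f)⟩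
      map_add' := fun f f' => Lip0.ext fun y => map_add (e.symm (g y)) f f'
      map_smul' := fun c f => Lip0.ext fun y => map_smul (e.symm (g y)) c f }
    K (fun f => Lip0.norm_le _ (by positivity) (hsub f))
  have hT : IsExtensionOperator X p T := fun f x => by
    change e.symm (g x) f = f x
    rw [hg', Lip0.eval_apply]
  refine (iInf₂_le T hT).trans ?_
  have hTn : ‖T‖ ≤ K := LinearMap.mkContinuous_norm_le _ K.2 _
  exact ENNReal.coe_le_coe.2 hTn

/-- A dual space is the range of a norm-one projection of its bidual. -/
theorem nuBidual_le_one_of_dual {E : Type u} [NormedAddCommGroup E] [NormedSpace ℝ E]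
    [CompleteSpace E] (hE : BanachClass.dual E) : nuBidual E ≤ 1 := by
  obtain ⟨G, _, _, _, ⟨e⟩⟩ := hE
  -- `j` is the canonical map of the predual `G` into `G** ≅ E*`; restricting `ξ ∈ E**` along it
  -- gives the projection `π`.
  let j : G →L[ℝ] StrongDual ℝ E :=
    (ContinuousLinearMap.flip (e : E →L[ℝ] StrongDual ℝ G))
  have hj : ‖j‖ ≤ 1 := by
    rw [ContinuousLinearMap.opNorm_flip]
    exact e.toLinearIsometry.norm_toContinuousLinearMap_le
  let π : StrongDual ℝ (StrongDual ℝ E) → E := fun ξ => e.symm (ξ.comp j)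
  have hπ : LipschitzWith 1 π := LipschitzWith.of_dist_le_mul fun ξ η => by
    rw [e.symm.dist_map, dist_eq_norm, dist_eq_norm, ← ContinuousLinearMap.sub_comp,
      NNReal.coe_one, one_mul]
    exact (ContinuousLinearMap.opNorm_comp_le _ _).trans
      (mul_le_of_le_one_right (norm_nonneg _) hj)
  have hπι : ∀ x, π (NormedSpace.inclusionInDoubleDual ℝ E x) = x := fun x => by
    refine (e.symm_apply_eq).2 ?_
    ext v
    rfl
  refine nuClass_le fun V _ _ _ _ f hf => ?_
  let ι' : E → Set.range (NormedSpace.inclusionInDoubleDual ℝ E) := fun x => ⟨_, x, rfl⟩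
  have hι' : LipschitzWith 1 ι' :=
    (NormedSpace.inclusionInDoubleDualLi ℝ (E := E)).isometry.lipschitz
  refine (extConst_le (K := 1) (g := f ∘ ι' ∘ π) ?_ ?_).trans (by simp)
  · have hl : LipschitzWith (lipConst f) f := lipschitzWith_lipConst (f := f) hf
    simpa using hl.comp (hι'.comp hπ)
  · rintro ⟨_, x, rfl⟩
    change f (ι' (π _)) = _
    rw [hπι]

/-- Reflexivity by dimension count: `E` is isometric to the dual of `E*`. -/
theorem dual_of_fin {E : Type u} [NormedAddCommGroup E] [NormedSpace ℝ E] [CompleteSpace E]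
    (hE : BanachClass.fin E) : BanachClass.dual E := by
  have : FiniteDimensional ℝ E := hE
  refine ⟨StrongDual ℝ E, inferInstance, inferInstance, inferInstance, ⟨?_⟩⟩
  refine (NormedSpace.inclusionInDoubleDualLi ℝ (E := E)).toLinearIsometryEquiv ?_
  have h : ∀ (V : Type u) [NormedAddCommGroup V] [NormedSpace ℝ V] [FiniteDimensional ℝ V],
      Module.finrank ℝ V = Module.finrank ℝ (StrongDual ℝ V) := fun V _ _ _ =>
    Subspace.dual_finrank_eq.symm.trans (LinearMap.toContinuousLinearMap (E := V)).finrank_eq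
  exact (h E).trans (h _)

theorem nuClass_dual_le (X : Set Y) : nuClass BanachClass.dual X ≤ lambdaLipFinite X := by
  refine (nuClass_le_mul X _).trans (mul_le_of_le_one_left' ?_)
  exact iSup_le fun E => iSup_le fun _ => iSup_le fun _ => iSup_le fun _ => iSup_le fun hE =>
    nuBidual_le_one_of_dual hE

theorem lambdaLip_le_nuClass_dual (X : Set Y) : lambdaLip X ≤ nuClass BanachClass.dual X := by
  rcases isEmpty_or_nonempty X with hX | ⟨⟨p⟩⟩
  · simp [lambdaLip]
  · exact lambdaLip_le_nuClass X _ p ⟨StrongDual ℝ (Lip0 p), inferInstance, inferInstance,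
      inferInstance, ⟨Lip0 p, inferInstance, inferInstance, inferInstance, ⟨.refl ℝ _⟩⟩,
      ⟨.refl ℝ _⟩⟩

theorem lambdaLip_le_nuClass_fin {F : Set Y} (hF : F.Finite) :
    lambdaLip F ≤ nuClass BanachClass.fin F := by
  rcases isEmpty_or_nonempty F with hX | ⟨⟨p⟩⟩
  · simp [lambdaLip]
  · have := hF.to_subtype
    exact lambdaLip_le_nuClass F _ p ⟨StrongDual ℝ (Lip0 p), inferInstance, inferInstance,
      inferInstance, (inferInstance : FiniteDimensional ℝ (StrongDual ℝ (Lip0 p))),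
      ⟨.refl ℝ _⟩⟩

end Extension

end LipExt

theorem theorem1p2 {Y : Type u} [MetricSpace Y] :
    (∀ (X : Set Y) (𝓑 : LipExt.BanachClass.{u}),
      LipExt.nuClass 𝓑 X ≤
        LipExt.bidualConst 𝓑 *
          ⨆ (F : Set Y) (_ : F ⊆ X) (_ : F.Finite), LipExt.lambdaLip F) ∧
    (∀ (X : Set Y) (𝓑 : LipExt.BanachClass.{u}) (p : X),
      𝓑.Contains (StrongDual ℝ (LipExt.Lip0 p)) →
        LipExt.lambdaLip X ≤ LipExt.nuClass 𝓑 X) ∧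
    LipExt.lambdaLipSpace Y = LipExt.nuClassSpace LipExt.BanachClass.dual Y ∧
    LipExt.nuClassSpace LipExt.BanachClass.dual Y =
      LipExt.nuClassSpace LipExt.BanachClass.fin Y := by
  refine ⟨LipExt.nuClass_le_mul, LipExt.lambdaLip_le_nuClass, le_antisymm ?_ ?_,
    le_antisymm ?_ ?_⟩
  · exact iSup_mono LipExt.lambdaLip_le_nuClass_dual
  · exact iSup_le fun X => (LipExt.nuClass_dual_le X).trans <|
      iSup_le fun F => iSup_le fun _ => iSup_le fun _ => le_iSup LipExt.lambdaLip F
  -- The passage to finite `F` is what allows finite-dimensional targets to suffice: `Lip₀(F)*` is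
  -- then one of them.
  · exact iSup_le fun X => (LipExt.nuClass_dual_le X).trans <|
      iSup_le fun F => iSup_le fun _ => iSup_le fun hF =>
        (LipExt.lambdaLip_le_nuClass_fin hF).trans <|
          le_iSup (LipExt.nuClass LipExt.BanachClass.fin) F
  · exact iSup_mono fun X => LipExt.nuClass_mono (fun _ _ _ _ => LipExt.dual_of_fin) X
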